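/- Setting. For each sample size $n$, let $\widehat\beta_C,\widehat\beta_E,\widehat V(\widehat\beta_C),\widehat V(\widehat\beta_E),\widehat{\mathrm{cov}}(\widehat\beta_C,\widehat\beta_E)$ be real random variables on a probability space that may depend on $n$, and let $\beta_0,\beta_E$ be real parameters that may depend on $n$. Let $\mu,\rho,\sigma_E\in\mathbb{R}$ and $\sigma_C>0$ be such that $\Sigma=\begin{pmatrix}\sigma_C^2&\rho\\ \rho&\sigma_E^2\end{pmatrix}$ is positive semidefinite, and let $(r_n)$ be a real sequence with $r_n\to\infty$ and $r_n/\sqrt n\to0$. Assume that $$\begin{pmatrix} r_n(\widehat\beta_C-\beta_0)\\ \sqrt n(\widehat\beta_E-\beta_E)\end{pmatrix}\xrightarrow{d}\mathcal N\left(\begin{pmatrix}\mu\\0\end{pmatrix},\Sigma\right)$$ and that $r_n^2\widehat V(\widehat\beta_C)\xrightarrow{p}\sigma_C^2$, $n\widehat V(\widehat\beta_E)\xrightarrow{p}\sigma_E^2$ and $\sqrt n\,r_n\widehat{\mathrm{cov}}(\widehat\beta_C,\widehat\beta_E)\xrightarrow{p}\rho$. Let $\widehat\beta_{MSE}=\widehat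 p\,\widehat\beta_E+(1-\widehat p)\widehat\beta_C$, where $\widehat p$ is a random variable that almost surely minimizes $$p\mapsto p^2(\widehat\beta_E-\widehat\beta_C)^2+p^2\widehat V(\widehat\beta_E)+(1-p)^2\widehat V(\widehat\beta_C)+2p(1-p)\widehat{\mathrm{cov}}(\widehat\beta_C,\widehat\beta_E)$$ over $p\in\mathbb{R}$ whenever this function has a minimizer (and is arbitrary otherwise). Let $V\sim\mathcal N(\mu,\sigma_C^2)$. Theorem. 1. If $\beta_0\neq\beta_E$ and $\beta_0,\beta_E$ do not depend on $n$, then $r_n(\widehat\beta_{MSE}-\beta_0)\xrightarrow{d}\mathcal N(\mu,\sigma_C^2)$. 2. If $\beta_0=\beta_E$ (for every $n$), then $r_n(\widehat\beta_{MSE}-\beta_0)\xrightarrow{d}U_0$, where $U_0=V\left(1-\frac{\sigma_C^2}{V^2+\sigma_C^2}\right)$; moreover $E(U_0^2)<E(V^2)<\infty$. 3. For $h\in\mathbb{R}$ let $U_h=V+(h-V)\frac{\sigma_C^2}{(h-V)^2+\sigma_C^2}$. Suppose that $|\mu/\sigma_C|\le 0.4$. If $\beta_E=\beta_0+h/r_n$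 (for every $n$) for some $h\in\mathbb{R}$, then $r_n(\widehat\beta_{MSE}-\beta_0)\xrightarrow{d}U_h$. Moreover $E(U_h^2)<\infty$ for all $h\in\mathbb{R}$, the two maxima below are attained, and $$\max_{h\in\mathbb{R}}\left[E(U_h^2)-(\mu^2+\sigma_C^2)\right]<\max_{h\in\mathbb{R}}\left[\mu^2+\sigma_C^2-E(U_h^2)\right].$$ -/

import Mathlib

open MeasureTheory ProbabilityTheory Filter Topology

universe u

/-- Convergence in probability of a sequence of real random variables to a constant, where the
`n`-th variable lives on its own probability space `(Ω n, P n)` (the data generating process may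
change with the sample size). -/
def TendstoInProb {Ω : ℕ → Type u} [∀ n, MeasurableSpace (Ω n)] (P : ∀ n, Measure (Ω n))
    (X : ∀ n, Ω n → ℝ) (c : ℝ) : Prop :=
  ∀ ε : ℝ, 0 < ε → Tendsto (fun n => P n {ω | ε ≤ |X n ω - c|}) atTop (𝓝 0)

/-- The set-up: `bC`, `bE` are the estimators, `vC`, `vE`, `cCE` the estimators of their variances
and of their covariance, `β0`, `βE` the (possibly sample-size dependent) parameters, and `r` the
rate of convergence of `bC`. -/
structure NonparamSetup {Ω : ℕ → Type u} [∀ n, MeasurableSpace (Ω n)]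
    (P : ∀ n, Measure (Ω n)) [∀ n, IsProbabilityMeasure (P n)] (r β0 βE : ℕ → ℝ)
    (bC bE vC vE cCE : ∀ n, Ω n → ℝ) (μ σC σE ρ : ℝ) : Prop where
  aemeasurable_bC : ∀ n, AEMeasurable (bC n) (P n)
  aemeasurable_bE : ∀ n, AEMeasurable (bE n) (P n)
  aemeasurable_vC : ∀ n, AEMeasurable (vC n) (P n)
  aemeasurable_vE : ∀ n, AEMeasurable (vE n) (P n)
  aemeasurable_cCE : ∀ n, AEMeasurable (cCE n) (P n)
  rate_tendsto : Tendsto r atTop atTop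
  rate_slow : Tendsto (fun n => r n / √(n : ℝ)) atTop (𝓝 0)
  sigmaC_pos : 0 < σC
  cov_posSemidef : (!![σC ^ 2, ρ; ρ, σE ^ 2] : Matrix (Fin 2) (Fin 2) ℝ).PosSemidef
  joint_normality : TendstoInDistribution
    (fun n ω => (!₂[r n * (bC n ω - β0 n), √(n : ℝ) * (bE n ω - βE n)] :
      EuclideanSpace ℝ (Fin 2)))
    atTop id P (multivariateGaussian !₂[μ, 0] !![σC ^ 2, ρ; ρ, σE ^ 2])
  vC_consistent : TendstoInProb P (fun n ω => r n ^ 2 * vC n ω) (σC ^ 2)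
  vE_consistent : TendstoInProb P (fun n ω => (n : ℝ) * vE n ω) (σE ^ 2)
  cCE_consistent : TendstoInProb P (fun n ω => √(n : ℝ) * r n * cCE n ω) ρ

/-- Estimated mean-squared error of `p * bE + (1 - p) * bC`. -/
def empMSE (bC bE vC vE cCE p : ℝ) : ℝ :=
  p ^ 2 * (bE - bC) ^ 2 + p ^ 2 * vE + (1 - p) ^ 2 * vC + 2 * p * (1 - p) * cCE

/-- `pHat` is a random weight that minimizes the estimated mean-squared error over `p ∈ ℝ`.
In the samples where that quadratic function of `p` has no minimizer (nothing in the set-up rules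
them out for a given `n`), the value of `pHat` is unrestricted. -/
structure IsEmpMSEWeight {Ω : ℕ → Type u} [∀ n, MeasurableSpace (Ω n)] (P : ∀ n, Measure (Ω n))
    (bC bE vC vE cCE pHat : ∀ n, Ω n → ℝ) : Prop where
  aemeasurable : ∀ n, AEMeasurable (pHat n) (P n)
  isMin : ∀ n, ∀ᵐ ω ∂(P n),
    (∃ p, IsMinOn (empMSE (bC n ω) (bE n ω) (vC n ω) (vE n ω) (cCE n ω)) Set.univ p) →
      IsMinOn (empMSE (bC n ω) (bE n ω) (vC n ω) (vE n ω) (cCE n ω)) Set.univ (pHat n ω)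

/-- The weighted sum of the two estimators. -/
def betaMSE {Ω : ℕ → Type u} (bC bE pHat : ∀ n, Ω n → ℝ) (n : ℕ) (ω : Ω n) : ℝ :=
  pHat n ω * bE n ω + (1 - pHat n ω) * bC n ω

/-- The limit `U_h` under local alternatives, as a function of the limit `v` of the normalized
consistent estimator: `U_h = V + (h - V) σ² / ((h - V)² + σ²)`. -/
noncomputable def limitU (σ h v : ℝ) : ℝ :=
  v + (h - v) * (σ ^ 2 / ((h - v) ^ 2 + σ ^ 2))

/-! Limits. The estimated MSE is a quadratic in `p` with leading coefficient `D = (bE - bC)² + vE +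
vC - 2 cCE`; when `D > 0` its only minimizer is `(vC - cCE) / D`. Put `k = r/√n`, `c = r² vC`, `e =
n vE`, `v = √n r cCE`, `x = r (bE - bC)` and `τ = k² e + c - 2 k v`. Then the rescaled error is `r
(bC - β0) + (c - k v) x / (x² + τ)`. Since `k → 0`, `τ` tends to `σC²` in probability, so replacing
`τ` by `max τ (σC²/2)` changes the error only on events of vanishing probability and makes it a
continuous function of the rescaled data. Slutsky's theorem and continuous mapping then give all
three limits: under local alternatives `x` tends to `h - V`, while for fixed distinct parameters `x`
grows like `r` and the correction vanishes.

Risk. Put `m = μ/σ`, `t = (h - μ)/σ` and `W = (h - V)/σ`, which has law N(t, 1). Then `U_h = σ (m -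
(W - t) + g(W))` with `g(w) = w/(1 + w²)`. Expanding the square and using Stein's identity `E (W -
t) g(W) = E g'(W)` gives `E U_h² - (μ² + σ²) = σ² (2 m A(t) + B(t))`, where `A` and `B` are the
Gaussian means of `oddKernel = g` and `evenKernel = g² - 2 g'`. The function `2 m A + B` is
continuous, tends to zero at infinity and takes both signs when `|m| ≤ 2/5`, so both extrema are
attained.

Loss against gain. By the symmetry `(m, t) ↦ (-m, -t)`, take `0 ≤ m ≤ 2/5`. The risk difference is
affine in `m`, so the endpoints suffice, with the gain measured at `t = -3/10`: at `m = 0` the loss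
is at most 0.45 and the gain at least 0.455; at `m = 2/5` they are at most 0.574 and at least 0.575
(`loss_mean_le`, `gain_mean_le`). Apart from the elementary bound 0.45, these estimates add a
mean-zero Stein term `f' - (w - t) f`, with `f` rational, to the integrand; the resulting pointwise
inequality is certified by sums of squares. -/

/-! ### Slutsky's theorem on varying probability spaces -/

section Convergence

variable {Ω : ℕ → Type u} [∀ n, MeasurableSpace (Ω n)] {P : ∀ n, Measure (Ω n)}
  [∀ n, IsProbabilityMeasure (P n)] {Ω' : Type*} [MeasurableSpace Ω'] {Q : Measure Ω'}
  [IsProbabilityMeasure Q] {E : Type*} [MeasurableSpace E]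

/-- Convergence in distribution only depends on the laws of the variables. -/
lemma tendstoInDistribution_of_map_eq [TopologicalSpace E] [OpensMeasurableSpace E]
    {Ω₂ : ℕ → Type*} [∀ n, MeasurableSpace (Ω₂ n)] {P₂ : ∀ n, Measure (Ω₂ n)}
    [∀ n, IsProbabilityMeasure (P₂ n)] {Ω₂' : Type*} [MeasurableSpace Ω₂'] {Q₂ : Measure Ω₂'}
    [IsProbabilityMeasure Q₂] {X : ∀ n, Ω n → E} {Z : Ω' → E} {X₂ : ∀ n, Ω₂ n → E} {Z₂ : Ω₂' → E}
    (h : TendstoInDistribution X atTop Z P Q) (hX₂ : ∀ n, AEMeasurable (X₂ n) (P₂ n))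
    (hZ₂ : AEMeasurable Z₂ Q₂) (hX : ∀ n, (P₂ n).map (X₂ n) = (P n).map (X n))
    (hZ : Q₂.map Z₂ = Q.map Z) :
    TendstoInDistribution X₂ atTop Z₂ P₂ Q₂ where
  forall_aemeasurable := hX₂
  aemeasurable_limit := hZ₂
  tendsto := by
    have h1 := h.tendsto
    simp only [← hX, ← hZ] at h1
    exact h1

/-- Lifting every variable to the infinite product space keeps its law. Convergence in distribution
and convergence in probability to a constant depend only on the individual laws, so Slutsky's
theorem on one common space applies there and is then transported back. -/
lemma map_comp_eval_infinitePi {X : ∀ n, Ω n → E} (hX : ∀ n, AEMeasurable (X n) (P n)) (n : ℕ) :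
    (Measure.infinitePi P).map (fun ω : ∀ n, Ω n => X n (ω n)) = (P n).map (X n) := by
  have h := measurePreserving_eval_infinitePi P n
  have h2 : AEMeasurable (X n) ((Measure.infinitePi P).map (Function.eval n)) := by
    rw [h.map_eq]; exact hX n
  have := AEMeasurable.map_map_of_aemeasurable h2 h.measurable.aemeasurable
  rw [h.map_eq] at this
  exact this.symm

lemma aemeasurable_comp_eval_infinitePi {X : ∀ n, Ω n → E} (hX : ∀ n, AEMeasurable (X n) (P n))
    (n : ℕ) : AEMeasurable (fun ω : ∀ n, Ω n => X n (ω n)) (Measure.infinitePi P) :=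
  (hX n).comp_quasiMeasurePreserving (measurePreserving_eval_infinitePi P n).quasiMeasurePreserving

lemma TendstoInProb.tendstoInMeasure {Y : ∀ n, Ω n → ℝ} {c : ℝ} (h : TendstoInProb P Y c)
    (hY : ∀ n, AEMeasurable (Y n) (P n)) :
    TendstoInMeasure (Measure.infinitePi P) (fun n (ω : ∀ n, Ω n) => Y n (ω n)) atTop
      (fun _ => c) := by
  rw [tendstoInMeasure_iff_norm]
  intro ε hε
  refine (h ε hε).congr fun n => ?_
  have hs : NullMeasurableSet {ω | ε ≤ |Y n ω - c|} (P n) :=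
    nullMeasurableSet_le aemeasurable_const (by fun_prop (disch := exact hY n))
  exact ((measurePreserving_eval_infinitePi P n).measure_preimage hs).symm

/-- Slutsky's theorem on varying probability spaces. -/
lemma TendstoInDistribution.prodMk_tendstoInProb [SeminormedAddCommGroup E]
    [SecondCountableTopology E] [BorelSpace E] {X : ∀ n, Ω n → E} {Z : Ω' → E}
    {Y : ∀ n, Ω n → ℝ} {c : ℝ} (hX : TendstoInDistribution X atTop Z P Q)
    (hY : TendstoInProb P Y c) (hYm : ∀ n, AEMeasurable (Y n) (P n)) :
    TendstoInDistribution (fun n ω => (X n ω, Y n ω)) atTop (fun x => (Z x, c)) P Q := by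
  have hX' : TendstoInDistribution (fun n (ω : ∀ n, Ω n) => X n (ω n)) atTop Z
      (fun _ => Measure.infinitePi P) Q :=
    tendstoInDistribution_of_map_eq hX (aemeasurable_comp_eval_infinitePi hX.forall_aemeasurable)
      hX.aemeasurable_limit (map_comp_eval_infinitePi hX.forall_aemeasurable) rfl
  have h := TendstoInDistribution.prodMk_of_tendstoInMeasure_const _ _ _ hX'
    (hY.tendstoInMeasure hYm) (aemeasurable_comp_eval_infinitePi hYm)
  have hm : ∀ n, AEMeasurable (fun ω => (X n ω, Y n ω)) (P n) :=
    fun n => (hX.forall_aemeasurable n).prodMk (hYm n)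
  exact tendstoInDistribution_of_map_eq h hm h.aemeasurable_limit
    (fun n => (map_comp_eval_infinitePi hm n).symm) rfl

/-- Changing the variables on events of vanishing probability preserves convergence in
distribution. -/
lemma TendstoInDistribution.congr_of_tendsto_measure_ne {X Y : ∀ n, Ω n → ℝ} {Z : Ω' → ℝ}
    (hX : TendstoInDistribution X atTop Z P Q) (hYm : ∀ n, AEMeasurable (Y n) (P n))
    (h : Tendsto (fun n => P n {ω | X n ω ≠ Y n ω}) atTop (𝓝 0)) :
    TendstoInDistribution Y atTop Z P Q := by
  have hsub : TendstoInProb P (fun n ω => Y n ω - X n ω) 0 := by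
    intro ε hε
    refine tendsto_of_tendsto_of_tendsto_of_le_of_le tendsto_const_nhds h (fun _ => zero_le)
      fun n => measure_mono fun ω hω hXY => ?_
    simp only [Set.mem_ofPred_eq, hXY, sub_self, abs_zero] at hω
    linarith
  have h1 := (TendstoInDistribution.prodMk_tendstoInProb hX hsub
    (fun n => (hYm n).sub (hX.forall_aemeasurable n))).continuous_comp
    (g := fun p : ℝ × ℝ => p.1 + p.2) (by fun_prop)
  refine h1.congr (fun n => ?_) ?_ <;> exact Eventually.of_forall fun ω => by simp

/-- Lets the deterministic sequences `r n / √n` and `(r n)⁻¹` be adjoined to the random data by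
Slutsky's theorem. -/
lemma tendstoInProb_of_tendsto {Ω : ℕ → Type u} [∀ n, MeasurableSpace (Ω n)]
    {P : ∀ n, Measure (Ω n)} {a : ℕ → ℝ} {c : ℝ} (h : Tendsto a atTop (𝓝 c)) :
    TendstoInProb P (fun n _ => a n) c := by
  intro ε hε
  refine tendsto_const_nhds.congr' ?_
  filter_upwards [Metric.tendsto_nhds.1 h ε hε] with n hn
  rw [Real.dist_eq] at hn
  simp [not_le.2 hn]

end Convergence

/-! ### The minimizing weight -/

section Weight

/-- Completing the square: the objective exceeds its value at `p₀` by `D * (p - p₀) ^ 2`. For `D >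
0` a minimizer therefore exists, which activates `hp`, and it is unique. -/
lemma eq_of_isMinOn_empMSE {bC bE vC vE c p : ℝ} (hD : 0 < (bE - bC) ^ 2 + vE + vC - 2 * c)
    (hp : (∃ p, IsMinOn (empMSE bC bE vC vE c) Set.univ p) →
      IsMinOn (empMSE bC bE vC vE c) Set.univ p) :
    p = (vC - c) / ((bE - bC) ^ 2 + vE + vC - 2 * c) := by
  set D := (bE - bC) ^ 2 + vE + vC - 2 * c with hDdef
  set p₀ := (vC - c) / D with hp₀
  have hmul : p₀ * D = vC - c := div_mul_cancel₀ _ hD.ne'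
  have key : ∀ x, empMSE bC bE vC vE c x = empMSE bC bE vC vE c p₀ + D * (x - p₀) ^ 2 := by
    intro x
    have : empMSE bC bE vC vE c x = D * x ^ 2 - 2 * (vC - c) * x + vC := by
      simp only [empMSE, hDdef]; ring
    have h2 : empMSE bC bE vC vE c p₀ = D * p₀ ^ 2 - 2 * (vC - c) * p₀ + vC := by
      simp only [empMSE, hDdef]; ring
    rw [this, h2, ← hmul]; ring
  have hmin := hp ⟨p₀, fun x _ => by
    simp only [Set.mem_ofPred_eq]; rw [key x]; nlinarith [sq_nonneg (x - p₀)]⟩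
  have h1 : empMSE bC bE vC vE c p ≤ empMSE bC bE vC vE c p₀ := hmin (Set.mem_univ p₀)
  rw [key p] at h1
  have h2 : (p - p₀) ^ 2 = 0 := by
    have := sq_nonneg (p - p₀)
    by_contra h
    have : 0 < (p - p₀) ^ 2 := lt_of_le_of_ne this (Ne.symm h)
    nlinarith [mul_pos hD this]
  nlinarith [pow_eq_zero_iff (two_ne_zero) |>.1 h2]

end Weight

/-! ### Limit distributions of the weighted estimator -/

namespace NonparamSetup

variable {Ω : ℕ → Type u} [∀ n, MeasurableSpace (Ω n)] {P : ∀ n, Measure (Ω n)}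
  [∀ n, IsProbabilityMeasure (P n)] {r β0 βE : ℕ → ℝ} {bC bE vC vE cCE pHat : ∀ n, Ω n → ℝ}
  {μ σC σE ρ : ℝ}

/-- The rescaled data: errors of the estimators, ratio of the rates, and variance estimates. -/
noncomputable def rescaled (r β0 βE : ℕ → ℝ) (bC bE vC vE cCE : ∀ n, Ω n → ℝ) (n : ℕ) (ω : Ω n) :
    ((((EuclideanSpace ℝ (Fin 2) × ℝ) × ℝ) × ℝ) × ℝ) × ℝ :=
  (((((!₂[r n * (bC n ω - β0 n), √(n : ℝ) * (bE n ω - βE n)], r n / √(n : ℝ)), (r n)⁻¹),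
    r n ^ 2 * vC n ω), (n : ℝ) * vE n ω), √(n : ℝ) * r n * cCE n ω)

lemma tendstoInDistribution_rescaled
    (h : NonparamSetup P r β0 βE bC bE vC vE cCE μ σC σE ρ) :
    TendstoInDistribution (rescaled r β0 βE bC bE vC vE cCE) atTop
      (fun z => (((((z, 0), 0), σC ^ 2), σE ^ 2), ρ)) P
      (multivariateGaussian !₂[μ, 0] !![σC ^ 2, ρ; ρ, σE ^ 2]) := by
  have hvC := h.aemeasurable_vC
  have hvE := h.aemeasurable_vE
  have hc := h.aemeasurable_cCE
  have h1 := TendstoInDistribution.prodMk_tendstoInProb h.joint_normality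
    (tendstoInProb_of_tendsto (P := P) h.rate_slow) (fun n => aemeasurable_const)
  have h2 := TendstoInDistribution.prodMk_tendstoInProb h1
    (tendstoInProb_of_tendsto (P := P) (tendsto_inv_atTop_zero.comp h.rate_tendsto))
    (fun n => aemeasurable_const)
  have h3 := TendstoInDistribution.prodMk_tendstoInProb h2 h.vC_consistent
    (fun n => (hvC n).const_mul _)
  have h4 := TendstoInDistribution.prodMk_tendstoInProb h3 h.vE_consistent
    (fun n => (hvE n).const_mul _)
  exact TendstoInDistribution.prodMk_tendstoInProb h4 h.cCE_consistent
    (fun n => (hc n).const_mul _)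

/-- The rescaled estimated variance of `bE - bC`. -/
noncomputable def scaledVarDiff (r : ℕ → ℝ) (vC vE cCE : ∀ n, Ω n → ℝ) (n : ℕ) (ω : Ω n) : ℝ :=
  (r n / √(n : ℝ)) ^ 2 * ((n : ℝ) * vE n ω) + r n ^ 2 * vC n ω
    - 2 * (r n / √(n : ℝ)) * (√(n : ℝ) * r n * cCE n ω)

lemma tendsto_measure_scaledVarDiff_lt
    (h : NonparamSetup P r β0 βE bC bE vC vE cCE μ σC σE ρ) :
    Tendsto (fun n => P n {ω | scaledVarDiff r vC vE cCE n ω < σC ^ 2 / 2}) atTop (𝓝 0) := by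
  have hσ : 0 < σC ^ 2 := pow_pos h.sigmaC_pos 2
  -- Off the three events below, `c > 3σC²/4`, `e > -1` and `|v| ≤ |ρ| + 1`, so `τ > 3σC²/4 - k² -
  -- 2|k|(|ρ| + 1)`. This exceeds `σC²/2` once `k` is small.
  have hsum := ((h.vC_consistent (σC ^ 2 / 4) (by positivity)).add
    (h.vE_consistent 1 one_pos)).add (h.cCE_consistent 1 one_pos)
  simp only [add_zero] at hsum
  refine tendsto_of_tendsto_of_tendsto_of_le_of_le' tendsto_const_nhds hsum
    (Eventually.of_forall fun _ => zero_le) ?_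
  have hk : Tendsto (fun n => (r n / √(n : ℝ)) ^ 2 + 2 * |r n / √(n : ℝ)| * (|ρ| + 1)) atTop
      (𝓝 (0 ^ 2 + 2 * |0| * (|ρ| + 1))) :=
    (h.rate_slow.pow 2).add ((h.rate_slow.abs.const_mul 2).mul_const _)
  have hk' := hk.eventually_lt_const (u := σC ^ 2 / 4) (by simpa using hσ)
  filter_upwards [hk'] with n hn
  refine le_trans (measure_mono ?_) ((measure_union_le _ _).trans
    (add_le_add (measure_union_le _ _) le_rfl))
  intro ω hω
  by_contra hcon
  simp only [Set.mem_union, Set.mem_ofPred_eq, not_or, not_le] at hcon hω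
  obtain ⟨⟨hC, hE⟩, hc⟩ := hcon
  set k := r n / √(n : ℝ)
  have e1 := abs_lt.1 hC
  have e2 := abs_lt.1 hE
  have e3 : |√(n : ℝ) * r n * cCE n ω| ≤ |ρ| + 1 := by
    have := abs_sub_abs_le_abs_sub (√(n : ℝ) * r n * cCE n ω) ρ
    linarith
  have e4 : k * (√(n : ℝ) * r n * cCE n ω) ≤ |k| * (|ρ| + 1) :=
    (le_abs_self _).trans (by rw [abs_mul]; gcongr)
  have e5 : -k ^ 2 ≤ k ^ 2 * ((n : ℝ) * vE n ω) := by
    nlinarith [sq_nonneg k, sq_nonneg σE]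
  unfold scaledVarDiff at hω
  change k ^ 2 * _ + _ - 2 * k * _ < _ at hω
  linarith

/-- The rescaled error of the weighted estimator is a continuous function of the rescaled data. -/
lemma scaled_error_eq {Ω : ℕ → Type u} {bC bE vC vE cCE pHat : ∀ n, Ω n → ℝ} {n : ℕ} {ω : Ω n}
    (hn : 0 < n) (hr : 0 < r n) (hσ : 0 < σC)
    (hp : (∃ p, IsMinOn (empMSE (bC n ω) (bE n ω) (vC n ω) (vE n ω) (cCE n ω)) Set.univ p) →
      IsMinOn (empMSE (bC n ω) (bE n ω) (vC n ω) (vE n ω) (cCE n ω)) Set.univ (pHat n ω))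
    (hτ : σC ^ 2 / 2 ≤ scaledVarDiff r vC vE cCE n ω) {x : ℝ}
    (hx : x = r n * (βE n - β0 n) + r n / √(n : ℝ) * (√(n : ℝ) * (bE n ω - βE n))
      - r n * (bC n ω - β0 n)) :
    r n * (betaMSE bC bE pHat n ω - β0 n) = r n * (bC n ω - β0 n) +
      (r n ^ 2 * vC n ω - r n / √(n : ℝ) * (√(n : ℝ) * r n * cCE n ω)) * x /
        (x ^ 2 + max (scaledVarDiff r vC vE cCE n ω) (σC ^ 2 / 2)) := by
  have hs : 0 < √(n : ℝ) := Real.sqrt_pos.2 (by exact_mod_cast hn)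
  have hx' : x = r n * (bE n ω - bC n ω) := by rw [hx]; field_simp; ring
  have hss : √(n : ℝ) ^ 2 = n := Real.sq_sqrt (by positivity)
  have hτ' : scaledVarDiff r vC vE cCE n ω = r n ^ 2 * (vE n ω + vC n ω - 2 * cCE n ω) := by
    have hn0 : (n : ℝ) ≠ 0 := by positivity
    have e1 : (r n / √(n : ℝ)) ^ 2 * ((n : ℝ) * vE n ω) = r n ^ 2 * vE n ω := by
      rw [div_pow, hss]; field_simp
    have e2 : r n / √(n : ℝ) * (√(n : ℝ) * r n * cCE n ω) = r n ^ 2 * cCE n ω := by field_simp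
    unfold scaledVarDiff
    rw [e1, mul_assoc 2, e2]
    ring
  have hc' : r n / √(n : ℝ) * (√(n : ℝ) * r n * cCE n ω) = r n ^ 2 * cCE n ω := by
    field_simp
  rw [max_eq_left hτ, hc', hx', hτ']
  rw [hτ'] at hτ
  have hpos : 0 < vE n ω + vC n ω - 2 * cCE n ω := by
    have : 0 < r n ^ 2 * (vE n ω + vC n ω - 2 * cCE n ω) := lt_of_lt_of_le (by positivity) hτ
    exact (mul_pos_iff_of_pos_left (by positivity)).1 this
  have hD : 0 < (bE n ω - bC n ω) ^ 2 + vE n ω + vC n ω - 2 * cCE n ω := by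
    nlinarith [sq_nonneg (bE n ω - bC n ω)]
  rw [betaMSE, eq_of_isMinOn_empMSE hD hp]
  have e : (r n * (bE n ω - bC n ω)) ^ 2 + r n ^ 2 * (vE n ω + vC n ω - 2 * cCE n ω) =
      r n ^ 2 * ((bE n ω - bC n ω) ^ 2 + vE n ω + vC n ω - 2 * cCE n ω) := by ring
  rw [e]
  generalize (bE n ω - bC n ω) ^ 2 + vE n ω + vC n ω - 2 * cCE n ω = D at hD
  field_simp
  ring

/-- If the rescaled error agrees, off the events where the estimated variance of `bE - bC` is small,
with a continuous function of the rescaled data, then it converges in distribution. -/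
lemma tendstoInDistribution_of_continuous
    (h : NonparamSetup P r β0 βE bC bE vC vE cCE μ σC σE ρ)
    (hp : IsEmpMSEWeight P bC bE vC vE cCE pHat)
    {Φ : ((((EuclideanSpace ℝ (Fin 2) × ℝ) × ℝ) × ℝ) × ℝ) × ℝ → ℝ}
    (hΦ : Continuous Φ)
    (hΦeq : ∀ᶠ n in atTop, ∀ ω, σC ^ 2 / 2 ≤ scaledVarDiff r vC vE cCE n ω →
      ((∃ p, IsMinOn (empMSE (bC n ω) (bE n ω) (vC n ω) (vE n ω) (cCE n ω)) Set.univ p) →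
        IsMinOn (empMSE (bC n ω) (bE n ω) (vC n ω) (vE n ω) (cCE n ω)) Set.univ (pHat n ω)) →
      Φ (rescaled r β0 βE bC bE vC vE cCE n ω) = r n * (betaMSE bC bE pHat n ω - β0 n))
    {Ω' : Type*} [MeasurableSpace Ω'] {Q : Measure Ω'} [IsProbabilityMeasure Q] {V : Ω' → ℝ}
    (hV : HasLaw V (gaussianReal μ (Real.toNNReal (σC ^ 2))) Q) {ψ : ℝ → ℝ} (hψ : Measurable ψ)
    (hlim : ∀ z : EuclideanSpace ℝ (Fin 2),
      Φ (((((z, 0), 0), σC ^ 2), σE ^ 2), ρ) = ψ (z 0)) :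
    TendstoInDistribution (fun n ω => r n * (betaMSE bC bE pHat n ω - β0 n)) atTop
      (fun x => ψ (V x)) P Q := by
  have h1 := h.tendstoInDistribution_rescaled.continuous_comp hΦ
  have hm : ∀ n, AEMeasurable (fun ω => r n * (betaMSE bC bE pHat n ω - β0 n)) (P n) := by
    intro n
    have a1 := h.aemeasurable_bC n
    have a2 := h.aemeasurable_bE n
    have a3 := hp.aemeasurable n
    unfold betaMSE
    fun_prop
  have h2 := TendstoInDistribution.congr_of_tendsto_measure_ne h1 hm (by
    refine tendsto_of_tendsto_of_tendsto_of_le_of_le' tendsto_const_nhds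
      h.tendsto_measure_scaledVarDiff_lt (Eventually.of_forall fun _ => zero_le) ?_
    filter_upwards [hΦeq] with n hn
    refine measure_mono_ae ?_
    filter_upwards [hp.isMin n] with ω hω hne
    by_contra hcon
    exact hne (hn ω (not_lt.1 hcon) hω))
  have hVm := hV.aemeasurable
  refine tendstoInDistribution_of_map_eq h2 hm (hψ.comp_aemeasurable hVm) (fun _ => rfl) ?_
  have hmp := measurePreserving_eval_multivariateGaussian (μ := !₂[μ, 0]) h.cov_posSemidef
    (i := (0 : Fin 2))
  have e1 : Q.map (fun x => ψ (V x)) = (gaussianReal μ (Real.toNNReal (σC ^ 2))).map ψ := by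
    rw [← hV.map_eq, AEMeasurable.map_map_of_aemeasurable hψ.aemeasurable hVm]; rfl
  rw [e1]
  have e2 : (Φ ∘ fun z : EuclideanSpace ℝ (Fin 2) => (((((z, (0:ℝ)), (0:ℝ)), σC ^ 2), σE ^ 2), ρ))
      = ψ ∘ fun z => z 0 := funext hlim
  rw [e2, ← Measure.map_map hψ hmp.measurable, hmp.map_eq]
  simp

/-- Local alternatives, `h = 0` being the case of equal parameters. -/
theorem tendstoInDistribution_local
    (hs : NonparamSetup P r β0 βE bC bE vC vE cCE μ σC σE ρ)
    (hp : IsEmpMSEWeight P bC bE vC vE cCE pHat)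
    {Ω' : Type*} [MeasurableSpace Ω'] {Q : Measure Ω'} [IsProbabilityMeasure Q] {V : Ω' → ℝ}
    (hV : HasLaw V (gaussianReal μ (Real.toNNReal (σC ^ 2))) Q) {h : ℝ}
    (hβ : ∀ n, βE n = β0 n + h / r n) :
    TendstoInDistribution (fun n ω => r n * (betaMSE bC bE pHat n ω - β0 n)) atTop
      (fun x => limitU σC h (V x)) P Q := by
  have hσ := hs.sigmaC_pos
  have hσ2 : 0 < σC ^ 2 := by positivity
  -- Here `x = h + k z₁ - z₀`, which becomes `h - z₀` at `k = 0`. The `max` keeps the denominator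
  -- positive everywhere, so the map is continuous on the whole space.
  refine hs.tendstoInDistribution_of_continuous hp
    (Φ := fun ⟨⟨⟨⟨⟨z, k⟩, _⟩, c⟩, e⟩, v⟩ => z 0 + (c - k * v) * (h + k * z 1 - z 0) /
      ((h + k * z 1 - z 0) ^ 2 + max (k ^ 2 * e + c - 2 * k * v) (σC ^ 2 / 2)))
    ?_ ?_ hV (ψ := limitU σC h) ?_ ?_
  · refine Continuous.add (by fun_prop) (Continuous.div (by fun_prop) (by fun_prop) ?_)
    rintro ⟨⟨⟨⟨⟨z, k⟩, _⟩, c⟩, e⟩, v⟩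
    have : 0 < max (k ^ 2 * e + c - 2 * k * v) (σC ^ 2 / 2) := lt_max_of_lt_right (by positivity)
    positivity
  · filter_upwards [hs.rate_tendsto.eventually_gt_atTop 0, eventually_gt_atTop 0] with n hr hn
    intro ω hτ hmin
    rw [scaled_error_eq (βE := βE) hn hr hσ hmin hτ rfl, hβ n]
    have : r n * (β0 n + h / r n - β0 n) = h := by field_simp; ring
    rw [this]
    simp [rescaled, scaledVarDiff, hβ n]
  · unfold limitU; fun_prop
  · intro z
    have : max (σC ^ 2) (σC ^ 2 / 2) = σC ^ 2 := max_eq_left (by linarith)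
    simp [limitU, this]
    ring

/-- Fixed, different parameters. -/
theorem tendstoInDistribution_fixed
    (hs : NonparamSetup P r β0 βE bC bE vC vE cCE μ σC σE ρ)
    (hp : IsEmpMSEWeight P bC bE vC vE cCE pHat) {d : ℝ} (hd : d ≠ 0)
    (hβ : ∀ n, βE n - β0 n = d) :
    TendstoInDistribution (fun n ω => r n * (betaMSE bC bE pHat n ω - β0 n)) atTop id P
      (gaussianReal μ (Real.toNNReal (σC ^ 2))) := by
  have hσ := hs.sigmaC_pos
  have hσ2 : 0 < σC ^ 2 := by positivity
  -- Now `x = r (d + i (k z₁ - z₀))` with `i = 1/r`. Dividing numerator and denominator by `r²`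
  -- gives an expression that still makes sense at `i = 0`, where the denominator is `d² ≠ 0` and
  -- the correction is zero.
  refine hs.tendstoInDistribution_of_continuous hp
    (Φ := fun ⟨⟨⟨⟨⟨z, k⟩, i⟩, c⟩, e⟩, v⟩ => z 0 +
      (c - k * v) * (i * (d + i * (k * z 1 - z 0))) /
      ((d + i * (k * z 1 - z 0)) ^ 2 + i ^ 2 * max (k ^ 2 * e + c - 2 * k * v) (σC ^ 2 / 2)))
    ?_ ?_ (HasLaw.id) (ψ := id) ?_ ?_
  · refine Continuous.add (by fun_prop) (Continuous.div (by fun_prop) (by fun_prop) ?_)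
    rintro ⟨⟨⟨⟨⟨z, k⟩, i⟩, c⟩, e⟩, v⟩
    have : 0 < max (k ^ 2 * e + c - 2 * k * v) (σC ^ 2 / 2) := lt_max_of_lt_right (by positivity)
    rcases eq_or_ne i 0 with rfl | hi
    · simpa using hd
    · positivity
  · filter_upwards [hs.rate_tendsto.eventually_gt_atTop 0, eventually_gt_atTop 0] with n hr hn
    intro ω hτ hmin
    rw [scaled_error_eq (βE := βE) hn hr hσ hmin hτ rfl, hβ n]
    simp only [rescaled, scaledVarDiff] at hτ ⊢
    set M := max _ (σC ^ 2 / 2) with hM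
    have hMpos : 0 < M := lt_max_of_lt_right (by positivity)
    simp only [Matrix.cons_val_zero, Matrix.cons_val_one]
    set y := r n / √(n : ℝ) * (√(n : ℝ) * (bE n ω - βE n)) - r n * (bC n ω - β0 n) with hy
    have e1 : r n * d + r n / √(n : ℝ) * (√(n : ℝ) * (bE n ω - βE n)) - r n * (bC n ω - β0 n)
      = r n * (d + (r n)⁻¹ * y) := by rw [hy]; field_simp; ring
    rw [e1]
    generalize d + (r n)⁻¹ * y = x
    have : (r n * x) ^ 2 + M = r n ^ 2 * (x ^ 2 + (r n)⁻¹ ^ 2 * M) := by field_simp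
    rw [this]
    have h3 : 0 < x ^ 2 + (r n)⁻¹ ^ 2 * M := by positivity
    generalize x ^ 2 + (r n)⁻¹ ^ 2 * M = D at h3
    field_simp
  · exact measurable_id
  · intro z
    simp

end NonparamSetup

/-! ### Stein's identity for the unit-variance normal law -/

section Stein

lemma integrable_gaussianPDFReal_mul {t : ℝ} {f : ℝ → ℝ} (hf : Integrable f (gaussianReal t 1)) :
    Integrable (fun w => gaussianPDFReal t 1 w * f w) := by
  rw [gaussianReal_of_var_ne_zero _ one_ne_zero,
    integrable_withDensity_iff_integrable_smul' (measurable_gaussianPDF _ _)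
      (Eventually.of_forall fun _ => gaussianPDF_lt_top)] at hf
  simpa [toReal_gaussianPDF] using hf

lemma integrable_of_continuous_of_bounded {t C : ℝ} {f : ℝ → ℝ} (hf : Continuous f)
    (hC : ∀ w, |f w| ≤ C) : Integrable f (gaussianReal t 1) :=
  Integrable.of_bound hf.aestronglyMeasurable C (Eventually.of_forall hC)

lemma integrable_sub_mul_of_bounded {t C : ℝ} {f : ℝ → ℝ} (hf : Continuous f)
    (hC : ∀ w, |f w| ≤ C) : Integrable (fun w => (w - t) * f w) (gaussianReal t 1) := by
  have h : Integrable (fun w : ℝ => w - t) (gaussianReal t 1) :=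
    ((memLp_id_gaussianReal 1).integrable (by simp)).sub (integrable_const t)
  exact h.mul_bdd hf.aestronglyMeasurable (Eventually.of_forall hC)

lemma hasDerivAt_gaussianPDFReal (t w : ℝ) :
    HasDerivAt (gaussianPDFReal t 1) (-(w - t) * gaussianPDFReal t 1 w) w := by
  have h : HasDerivAt (fun x : ℝ => -(x - t) ^ 2 / (2 * ((1 : NNReal) : ℝ))) (-(w - t)) w := by
    convert! ((((hasDerivAt_id w).sub_const t).pow 2).neg.div_const (2 * ((1 : NNReal) : ℝ)))
      using 1
    simp
    ring
  have h2 := (h.exp.const_mul (√(2 * Real.pi * ((1 : NNReal) : ℝ)))⁻¹)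
  rw [gaussianPDFReal_def]
  convert! h2 using 1
  ring

/-- **Stein's identity** for the normal law with unit variance. -/
lemma integral_stein {t C C' : ℝ} {f f' : ℝ → ℝ} (hf : ∀ w, HasDerivAt f (f' w) w)
    (hf' : Continuous f') (hC : ∀ w, |f w| ≤ C) (hC' : ∀ w, |f' w| ≤ C') :
    ∫ w, (f' w - (w - t) * f w) ∂(gaussianReal t 1) = 0 := by
  have hfc : Continuous f := continuous_iff_continuousAt.2 fun w => (hf w).continuousAt
  rw [integral_gaussianReal_eq_integral_smul one_ne_zero]
  simp only [smul_eq_mul]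
  -- Against Lebesgue measure, the integrand is the derivative of density times `f`; both are
  -- integrable, so the integral over the line is zero.
  refine integral_eq_zero_of_hasDerivAt_of_integrable
    (f := fun w => gaussianPDFReal t 1 w * f w) (fun w => ?_)
    (integrable_gaussianPDFReal_mul ((integrable_of_continuous_of_bounded hf' hC').sub
      (integrable_sub_mul_of_bounded hfc hC)))
    (integrable_gaussianPDFReal_mul (integrable_of_continuous_of_bounded hfc hC))
  convert! (hasDerivAt_gaussianPDFReal t w).mul (hf w) using 1
  ring

/-- Stein's method for an upper bound on a Gaussian expectation. -/
lemma integral_le_of_stein {t C B B' M : ℝ} {φ f f' : ℝ → ℝ} (hf : ∀ w, HasDerivAt f (f' w) w)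
    (hf' : Continuous f') (hB : ∀ w, |f w| ≤ B) (hB' : ∀ w, |f' w| ≤ B') (hφ : Continuous φ)
    (hM : ∀ w, |φ w| ≤ M) (h : ∀ w, φ w + (f' w - (w - t) * f w) ≤ C) :
    ∫ w, φ w ∂(gaussianReal t 1) ≤ C := by
  have hfc : Continuous f := continuous_iff_continuousAt.2 fun w => (hf w).continuousAt
  have h1 := integrable_of_continuous_of_bounded (t := t) hφ hM
  have h2 : Integrable (fun w => f' w - (w - t) * f w) (gaussianReal t 1) :=
    (integrable_of_continuous_of_bounded hf' hB').sub (integrable_sub_mul_of_bounded hfc hB)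
  have h3 : ∫ w, (φ w + (f' w - (w - t) * f w)) ∂(gaussianReal t 1)
      = ∫ w, φ w ∂(gaussianReal t 1) := by
    rw [integral_add h1 h2, integral_stein hf hf' hB hB', add_zero]
  rw [← h3]
  calc _ ≤ ∫ _w, C ∂(gaussianReal t 1) := integral_mono (h1.add h2) (integrable_const C) h
    _ = C := by simp

end Stein

/-! ### Rational kernels and test functions -/

section RationalKernels

/-- `w / (1 + w²)`. -/
noncomputable def oddKernel (w : ℝ) : ℝ := w / (1 + w ^ 2)

/-- `(3 w² - 2) / (1 + w²)²`. -/
noncomputable def evenKernel (w : ℝ) : ℝ := (3 * w ^ 2 - 2) / (1 + w ^ 2) ^ 2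

/-- A rational test function vanishing at infinity, for Stein's method. -/
noncomputable def ratTest (α β : Fin 4 → ℝ) (w : ℝ) : ℝ :=
  ∑ k : Fin 4, (α k + β k * w) / (1 + w ^ 2) ^ (k.val + 1)

/-- The derivative of `ratTest`. -/
noncomputable def ratTestDeriv (α β : Fin 4 → ℝ) (w : ℝ) : ℝ :=
  ∑ k : Fin 4, (β k / (1 + w ^ 2) ^ (k.val + 1)
    - 2 * (k.val + 1) * w * (α k + β k * w) / (1 + w ^ 2) ^ (k.val + 2))

lemma ratTest_eq (α β : Fin 4 → ℝ) (w : ℝ) :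
    ratTest α β w = (α 0 + β 0 * w) / (1 + w ^ 2) + (α 1 + β 1 * w) / (1 + w ^ 2) ^ 2 +
      (α 2 + β 2 * w) / (1 + w ^ 2) ^ 3 + (α 3 + β 3 * w) / (1 + w ^ 2) ^ 4 := by
  rw [ratTest, Fin.sum_univ_four]
  change _ / (1 + w ^ 2) ^ 1 + _ / (1 + w ^ 2) ^ 2 + _ / (1 + w ^ 2) ^ 3 + _ / (1 + w ^ 2) ^ 4 = _
  rw [pow_one]

lemma ratTestDeriv_eq (α β : Fin 4 → ℝ) (w : ℝ) :
    ratTestDeriv α β w =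
      (β 0 / (1 + w ^ 2) - 2 * w * (α 0 + β 0 * w) / (1 + w ^ 2) ^ 2) +
      (β 1 / (1 + w ^ 2) ^ 2 - 4 * w * (α 1 + β 1 * w) / (1 + w ^ 2) ^ 3) +
      (β 2 / (1 + w ^ 2) ^ 3 - 6 * w * (α 2 + β 2 * w) / (1 + w ^ 2) ^ 4) +
      (β 3 / (1 + w ^ 2) ^ 4 - 8 * w * (α 3 + β 3 * w) / (1 + w ^ 2) ^ 5) := by
  rw [ratTestDeriv, Fin.sum_univ_four]
  change (_ / (1 + w ^ 2) ^ 1 - 2 * (((0 : ℕ) : ℝ) + 1) * w * _ / (1 + w ^ 2) ^ 2) +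
    (_ / (1 + w ^ 2) ^ 2 - 2 * (((1 : ℕ) : ℝ) + 1) * w * _ / (1 + w ^ 2) ^ 3) +
    (_ / (1 + w ^ 2) ^ 3 - 2 * (((2 : ℕ) : ℝ) + 1) * w * _ / (1 + w ^ 2) ^ 4) +
    (_ / (1 + w ^ 2) ^ 4 - 2 * (((3 : ℕ) : ℝ) + 1) * w * _ / (1 + w ^ 2) ^ 5) = _
  rw [pow_one]
  norm_num

lemma one_add_sq_pos (w : ℝ) : 0 < 1 + w ^ 2 := by positivity

lemma continuous_oddKernel : Continuous oddKernel :=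
  Continuous.div (by fun_prop) (by fun_prop) fun w => (one_add_sq_pos w).ne'

lemma continuous_evenKernel : Continuous evenKernel :=
  Continuous.div (by fun_prop) (by fun_prop) fun w => (pow_pos (one_add_sq_pos w) 2).ne'

lemma abs_oddKernel_le (w : ℝ) : |oddKernel w| ≤ 1 := by
  rw [oddKernel, abs_div, abs_of_pos (one_add_sq_pos w), div_le_one (one_add_sq_pos w)]
  rw [abs_le]; constructor <;> nlinarith [sq_nonneg (w - 1), sq_nonneg (w + 1)]

lemma abs_evenKernel_le (w : ℝ) : |evenKernel w| ≤ 3 := by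
  have := pow_pos (one_add_sq_pos w) 2
  rw [evenKernel, abs_div, abs_of_pos this, div_le_iff₀ this, abs_le]
  constructor <;> nlinarith [sq_nonneg w, sq_nonneg (w ^ 2)]

/-- The maximum is attained at `w² = 7/3`, whence the square in the hint. -/
lemma evenKernel_le (w : ℝ) : evenKernel w ≤ 9 / 20 := by
  rw [evenKernel, div_le_iff₀ (pow_pos (one_add_sq_pos w) 2)]
  nlinarith [sq_nonneg (3 * w ^ 2 - 7)]

lemma hasDerivAt_ratTest (α β : Fin 4 → ℝ) (w : ℝ) :
    HasDerivAt (ratTest α β) (ratTestDeriv α β w) w := by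
  unfold ratTest ratTestDeriv
  refine HasDerivAt.fun_sum fun k _ => ?_
  have hD := one_add_sq_pos w
  have h1 : HasDerivAt (fun w => α k + β k * w) (β k) w := by
    simpa using ((hasDerivAt_id w).const_mul (β k)).const_add (α k)
  have h2 : HasDerivAt (fun w : ℝ => (1 + w ^ 2) ^ (k.val + 1))
      ((k.val + 1) * (1 + w ^ 2) ^ k.val * (2 * w)) w := by
    simpa using ((hasDerivAt_pow 2 w).const_add 1).fun_pow (k.val + 1)
  convert! h1.div h2 (pow_pos hD _).ne' using 1
  field_simp
  ring

lemma continuous_ratTestDeriv (α β : Fin 4 → ℝ) : Continuous (ratTestDeriv α β) := by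
  refine continuous_finsetSum _ fun k _ => ?_
  refine Continuous.sub ?_ ?_ <;>
    exact Continuous.div (by fun_prop) (by fun_prop) fun w => (pow_pos (one_add_sq_pos w) _).ne'

lemma abs_affine_div_le (a b : ℝ) (n : ℕ) (w : ℝ) :
    |(a + b * w) / (1 + w ^ 2) ^ (n + 1)| ≤ |a| + |b| := by
  have hD := one_add_sq_pos w
  have h1 : 1 + w ^ 2 ≤ (1 + w ^ 2) ^ (n + 1) :=
    le_self_pow₀ (by nlinarith [sq_nonneg w]) (by omega)
  rw [abs_div, abs_of_pos (pow_pos hD (n + 1)), div_le_iff₀ (pow_pos hD _)]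
  have hw : |w| ≤ 1 + w ^ 2 := by
    rw [abs_le]; constructor <;> nlinarith [sq_nonneg (w - 1), sq_nonneg (w + 1)]
  calc |a + b * w| ≤ |a| + |b| * |w| := by rw [← abs_mul]; exact abs_add_le _ _
    _ ≤ |a| * (1 + w ^ 2) + |b| * (1 + w ^ 2) := by
      gcongr; nlinarith [abs_nonneg a, sq_nonneg w]
    _ = (|a| + |b|) * (1 + w ^ 2) := by ring
    _ ≤ _ := by gcongr

lemma abs_ratTest_le (α β : Fin 4 → ℝ) (w : ℝ) :
    |ratTest α β w| ≤ ∑ k : Fin 4, (|α k| + |β k|) :=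
  (Finset.abs_sum_le_sum_abs _ _).trans (Finset.sum_le_sum fun _ _ => abs_affine_div_le _ _ _ _)

lemma abs_ratTestDeriv_le (α β : Fin 4 → ℝ) (w : ℝ) :
    |ratTestDeriv α β w| ≤ ∑ k : Fin 4, (|β k| + 2 * (k.val + 1) * (|α k| + |β k|)) := by
  refine (Finset.abs_sum_le_sum_abs _ _).trans (Finset.sum_le_sum fun k _ => ?_)
  have hD := one_add_sq_pos w
  have h1 := abs_affine_div_le (β k) 0 k.val w
  simp only [zero_mul, add_zero, abs_zero] at h1
  have h2 := abs_affine_div_le (α k) (β k) k.val w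
  have h3 := abs_oddKernel_le w
  -- Splitting off the bounded factor `w / (1 + w²)` leaves a summand of `ratTest`, already bounded.
  have e : 2 * (k.val + 1) * w * (α k + β k * w) / (1 + w ^ 2) ^ (k.val + 2)
      = 2 * (k.val + 1) * (oddKernel w * ((α k + β k * w) / (1 + w ^ 2) ^ (k.val + 1))) := by
    unfold oddKernel; field_simp; ring
  refine (abs_sub _ _).trans (add_le_add h1 ?_)
  rw [e, abs_mul, abs_mul (oddKernel w), abs_of_nonneg (by positivity)]
  gcongr
  calc _ ≤ 1 * (|α k| + |β k|) := by gcongr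
    _ = _ := one_mul _

/-- The Gaussian expectation of `oddKernel`. -/
noncomputable def oddMean (t : ℝ) : ℝ := ∫ w, oddKernel w ∂(gaussianReal t 1)

/-- The Gaussian expectation of `evenKernel`. -/
noncomputable def evenMean (t : ℝ) : ℝ := ∫ w, evenKernel w ∂(gaussianReal t 1)

lemma integrable_oddKernel (t : ℝ) : Integrable oddKernel (gaussianReal t 1) :=
  integrable_of_continuous_of_bounded continuous_oddKernel abs_oddKernel_le

lemma integrable_evenKernel (t : ℝ) : Integrable evenKernel (gaussianReal t 1) :=
  integrable_of_continuous_of_bounded continuous_evenKernel abs_evenKernel_le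

/-- The combination `a * oddKernel + b * evenKernel`, corrected by a function whose expectation
under the normal law with mean `t` and unit variance vanishes by Stein's identity. -/
noncomputable def corrected (a b t : ℝ) (α β : Fin 4 → ℝ) (w : ℝ) : ℝ :=
  a * oddKernel w + b * evenKernel w + (ratTestDeriv α β w - (w - t) * ratTest α β w)

lemma mean_le_of_corrected_le {t a b C : ℝ} {α β : Fin 4 → ℝ}
    (h : ∀ w, corrected a b t α β w ≤ C) : a * oddMean t + b * evenMean t ≤ C := by
  have e : a * oddMean t + b * evenMean t
      = ∫ w, (a * oddKernel w + b * evenKernel w) ∂(gaussianReal t 1) := by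
    rw [integral_add ((integrable_oddKernel t).const_mul a)
      ((integrable_evenKernel t).const_mul b), integral_const_mul, integral_const_mul]
    rfl
  rw [e]
  refine integral_le_of_stein (M := |a| * 1 + |b| * 3) (hasDerivAt_ratTest α β)
    (continuous_ratTestDeriv α β) (abs_ratTest_le α β) (abs_ratTestDeriv_le α β)
    ((continuous_oddKernel.const_mul a).add (continuous_evenKernel.const_mul b)) (fun w => ?_) h
  refine (abs_add_le _ _).trans ?_
  rw [abs_mul, abs_mul]
  gcongr
  · exact abs_oddKernel_le w
  · exact abs_evenKernel_le w

end RationalKernels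

/-! ### Sum-of-squares certificates for pointwise bounds -/

section Certificates

/-- In this and the following certificates, the slack times a power of `1 + w²` is a polynomial,
written as two squares plus a diagonally dominant quadratic form in the powers of `w`. Positivity is
then visible, and the identity is checked by `ring`. -/
lemma corrected_left_le (w : ℝ) : corrected (4 / 5) 1 (99 / 50) ![29 / 200, 813 / 500,
    -124 / 125, 0] ![0, 197 / 200, -119 / 1000, 0] w ≤ 287 / 500 := by
  have hD := one_add_sq_pos w
  rw [← sub_nonneg]
  simp only [corrected, ratTest_eq, ratTestDeriv_eq, oddKernel, evenKernel, Matrix.cons_val]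
  refine (show (0 : ℝ) ≤ (
      (37 / 250 - 1 / 125 * w - 34 / 25 * w ^ 2 - 87 / 200 * w ^ 3 + 753 / 1000 * w ^ 4) ^ 2 +
      (-(369 / 1000) + 151 / 125 * w + 1167 / 1000 * w ^ 2 - 679 / 500 * w ^ 3) ^ 2 +
      7419 / 1000000 + 2477 / 500000 * w ^ 2 + 8043 / 1000000 * w ^ 4 + 511 / 62500 * w ^ 6 +
      867 / 125000 * w ^ 8 + 3 / 31250 * (w + 1) ^ 2 + 41 / 125000 * (w * (w - 1)) ^ 2 +
      11 / 25000 * (w ^ 2 * (w - 1)) ^ 2 + 11 / 200000 * (w ^ 3 * (w + 1)) ^ 2) /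
      (1 + w ^ 2) ^ 4 by positivity).trans_eq ?_
  field_simp
  ring

lemma ratTest_left_nonneg (w : ℝ) : 0 ≤ ratTest ![29 / 200, 813 / 500, -124 / 125, 0] ![0,
    197 / 200, -119 / 1000, 0] w := by
  have hD := one_add_sq_pos w
  simp only [ratTest_eq, Matrix.cons_val]
  refine (show (0 : ℝ) ≤ (
      (87 / 1000 + 1309 / 1000 * w + 47 / 125 * w ^ 2) ^ 2 + (-(219 / 250) - 91 / 250 * w) ^ 2
      + 1901 / 500000 + 403 / 100000 * w ^ 2 + 827 / 250000 * w ^ 4 + 253 / 1000000 * (w +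
      1) ^ 2 + 79 / 250000 * (w * (w + 1)) ^ 2) /
      (1 + w ^ 2) ^ 3 by positivity).trans_eq ?_
  field_simp
  ring

lemma corrected_right_le (w : ℝ) : corrected (4 / 5) 1 (263 / 100) ![-969 / 200,
    -3159 / 1000, 6111 / 1000, 0] ![0, 12317 / 1000, -511 / 100, 0] w ≤ 287 / 500 := by
  have hD := one_add_sq_pos w
  rw [← sub_nonneg]
  simp only [corrected, ratTest_eq, ratTestDeriv_eq, oddKernel, evenKernel, Matrix.cons_val]
  refine (show (0 : ℝ) ≤ (
      (18 / 625 - 2119 / 2000 * w + 45407 / 10000 * w ^ 2 - 3743 / 1000 * w ^ 3 +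
      7541 / 10000 * w ^ 4) ^ 2 + (2913 / 5000 - 62193 / 10000 * w + 35571 / 5000 * w ^ 2 -
      9343 / 5000 * w ^ 3) ^ 2 + 258251 / 50000000 + 464479 / 100000000 * w ^ 2 +
      594939 / 100000000 * w ^ 4 + 480317 / 100000000 * w ^ 6 + 523689 / 100000000 * w ^ 8 +
      8639 / 50000000 * (w + 1) ^ 2 + 39953 / 100000000 * (w * (w - 1)) ^ 2 +
      45183 / 100000000 * (w ^ 2 * (w - 1)) ^ 2 + 963 / 10000000 * (w ^ 3 * (w + 1)) ^ 2) /
      (1 + w ^ 2) ^ 4 by positivity).trans_eq ?_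
  field_simp
  ring

lemma ratTest_right_nonpos (w : ℝ) : ratTest ![-969 / 200, -3159 / 1000, 6111 / 1000, 0]
    ![0, 12317 / 1000, -511 / 100, 0] w ≤ 0 := by
  have hD := one_add_sq_pos w
  rw [← neg_nonneg]
  simp only [ratTest_eq, Matrix.cons_val]
  refine (show (0 : ℝ) ≤ (
      (179 / 250 - 2799 / 1000 * w + 11 / 5 * w ^ 2) ^ 2 + (1173 / 1000 - 341 / 250 * w) ^ 2 +
      3859 / 1000000 + 2447 / 1000000 * w ^ 2 + 43 / 10000 * w ^ 4 + 139 / 250000 * (w +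
      1) ^ 2 + 7 / 10000 * (w * (w - 1)) ^ 2) /
      (1 + w ^ 2) ^ 3 by positivity).trans_eq ?_
  field_simp
  ring

lemma corrected_middle_le (w : ℝ) : corrected (4 / 5) 1 (99 / 50) ![-21 / 125, 1103 / 1000,
    -27 / 100, 0] ![-66 / 125, 2533 / 1000, -601 / 500, 0] w ≤ 287 / 500 := by
  have hD := one_add_sq_pos w
  rw [← sub_nonneg]
  simp only [corrected, ratTest_eq, ratTestDeriv_eq, oddKernel, evenKernel, Matrix.cons_val]
  refine (show (0 : ℝ) ≤ (
      (72 / 125 + 1581 / 1000 * w - 1317 / 500 * w ^ 2 + 39 / 200 * w ^ 3 +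
      199 / 1000 * w ^ 4) ^ 2 + (-(17 / 50) + 803 / 500 * w + 441 / 250 * w ^ 2 -
      41 / 40 * w ^ 3) ^ 2 + 601 / 100000 + 1167 / 1000000 * w ^ 2 + 4241 / 1000000 * w ^ 4 +
      4169 / 500000 * w ^ 6 + 3157 / 500000 * w ^ 8 + 457 / 500000 * (w + 1) ^ 2 +
      13 / 20000 * (w * (w - 1)) ^ 2 + 899 / 1000000 * (w ^ 2 * (w - 1)) ^ 2 +
      17 / 200000 * (w ^ 3 * (w - 1)) ^ 2) /
      (1 + w ^ 2) ^ 4 by positivity).trans_eq ?_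
  field_simp
  ring

lemma corrected_middle_le' (w : ℝ) : corrected (4 / 5) 1 (263 / 100) ![-21 / 125,
    1103 / 1000, -27 / 100, 0] ![-66 / 125, 2533 / 1000, -601 / 500, 0] w ≤ 287 / 500 := by
  have hD := one_add_sq_pos w
  rw [← sub_nonneg]
  simp only [corrected, ratTest_eq, ratTestDeriv_eq, oddKernel, evenKernel, Matrix.cons_val]
  refine (show (0 : ℝ) ≤ (
      (1407 / 10000 + 3639 / 5000 * w - 24293 / 10000 * w ^ 2 + 628 / 625 * w ^ 3 +
      2093 / 10000 * w ^ 4) ^ 2 + (83 / 10000 + 2597 / 10000 * w + 687 / 10000 * w ^ 2 -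
      4051 / 10000 * w ^ 3) ^ 2 + 43653 / 20000000 + 107791 / 50000000 * w ^ 2 +
      229951 / 100000000 * w ^ 4 + 19731 / 10000000 * w ^ 6 + 43563 / 20000000 * w ^ 8 +
      197 / 100000000 * (w - 1) ^ 2 + 247 / 25000000 * (w * (w - 1)) ^ 2 +
      2747 / 100000000 * (w ^ 2 * (w + 1)) ^ 2 + 6 / 390625 * (w ^ 3 * (w + 1)) ^ 2) /
      (1 + w ^ 2) ^ 4 by positivity).trans_eq ?_
  field_simp
  ring

lemma corrected_gain_even_le (w : ℝ) : corrected 0 1 (-3 / 10) ![-219 / 1000, 23 / 500, 0,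
    0] ![963 / 1000, 261 / 500, 0, 0] w ≤ -91 / 200 := by
  have hD := one_add_sq_pos w
  rw [← sub_nonneg]
  simp only [corrected, ratTest_eq, ratTestDeriv_eq, oddKernel, evenKernel, Matrix.cons_val]
  refine (show (0 : ℝ) ≤ (
      (-(3 / 250) - 381 / 500 * w + 49 / 1000 * w ^ 2 + 177 / 250 * w ^ 3) ^ 2 + (1 / 25 +
      1 / 125 * w - 227 / 1000 * w ^ 2) ^ 2 + 3071 / 500000 + 833 / 125000 * w ^ 2 +
      2477 / 500000 * w ^ 4 + 3239 / 500000 * w ^ 6 + 107 / 500000 * (w - 1) ^ 2 +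
      3 / 20000 * (w * (w - 1)) ^ 2 + 129 / 500000 * (w ^ 2 * (w + 1)) ^ 2) /
      (1 + w ^ 2) ^ 3 by positivity).trans_eq ?_
  field_simp
  ring

lemma corrected_gain_le (w : ℝ) : corrected (4 / 5) 1 (-3 / 10) ![483 / 1000, -59 / 100,
    431 / 1000, -13 / 100] ![177 / 250, 1491 / 1000, -211 / 200, 169 / 500] w ≤ -23 / 40 := by
  have hD := one_add_sq_pos w
  rw [← sub_nonneg]
  simp only [corrected, ratTest_eq, ratTestDeriv_eq, oddKernel, evenKernel, Matrix.cons_val]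
  refine (show (0 : ℝ) ≤ (
      (-(19 / 1250) + 1651 / 5000 * w + 309 / 2000 * w ^ 2 - 2739 / 2500 * w ^ 3 -
      719 / 5000 * w ^ 4 + 909 / 2500 * w ^ 5) ^ 2 + (-(137 / 10000) - 59 / 2500 * w +
      3457 / 10000 * w ^ 2 + 41 / 1000 * w ^ 3 - 69 / 250 * w ^ 4) ^ 2 + 77699 / 100000000 +
      1549 / 2000000 * w ^ 2 + 21199 / 25000000 * w ^ 4 + 33433 / 50000000 * w ^ 6 +
      8863 / 12500000 * w ^ 8 + 9759 / 12500000 * w ^ 10 + 107 / 25000000 * (w - 1) ^ 2 +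
      3 / 2500000 * (w * (w + 1)) ^ 2 + 381 / 50000000 * (w ^ 2 * (w - 1)) ^ 2 +
      1063 / 25000000 * (w ^ 3 * (w + 1)) ^ 2 + 179 / 12500000 * (w ^ 4 * (w - 1)) ^ 2) /
      (1 + w ^ 2) ^ 5 by positivity).trans_eq ?_
  field_simp
  ring

lemma corrected_neg_even_le (w : ℝ) : corrected 0 (-1) 3 ![-1 / 5, -427 / 1000, 0, 0]
    ![479 / 1000, -147 / 100, 0, 0] w ≤ -1 / 20 := by
  have hD := one_add_sq_pos w
  rw [← sub_nonneg]
  simp only [corrected, ratTest_eq, ratTestDeriv_eq, oddKernel, evenKernel, Matrix.cons_val]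
  refine (show (0 : ℝ) ≤ (
      (163 / 250 - 411 / 1000 * w - 807 / 500 * w ^ 2 + 507 / 1000 * w ^ 3) ^ 2 + (237 / 500 +
      409 / 500 * w - 257 / 250 * w ^ 2) ^ 2 + 8573 / 50000 + 168909 / 1000000 * w ^ 2 +
      85143 / 500000 * w ^ 4 + 171749 / 1000000 * w ^ 6 + 19 / 25000 * (w - 1) ^ 2 +
      743 / 500000 * (w * (w + 1)) ^ 2 + 101 / 500000 * (w ^ 2 * (w - 1)) ^ 2) /
      (1 + w ^ 2) ^ 3 by positivity).trans_eq ?_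
  field_simp
  ring

end Certificates

/-! ### Bounds, symmetry and decay of the Gaussian means -/

section Means

/-- `corrected` is affine in `t` with slope `ratTest α β w`, so the sign of the test function lets a
bound at one mean propagate to a half-line of means. -/
lemma corrected_le_of_nonneg {a b s t C : ℝ} {α β : Fin 4 → ℝ} {w : ℝ} (hst : t ≤ s)
    (h : 0 ≤ ratTest α β w) (hs : corrected a b s α β w ≤ C) : corrected a b t α β w ≤ C := by
  unfold corrected at *
  nlinarith

lemma corrected_le_of_nonpos {a b s t C : ℝ} {α β : Fin 4 → ℝ} {w : ℝ} (hst : s ≤ t)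
    (h : ratTest α β w ≤ 0) (hs : corrected a b s α β w ≤ C) : corrected a b t α β w ≤ C := by
  unfold corrected at *
  nlinarith

/-- An affine function of `t` is bounded on an interval by its endpoint values, so one test function
certified at two means covers everything between them. -/
lemma corrected_le_of_mem_Icc {a b s s' t C : ℝ} {α β : Fin 4 → ℝ} {w : ℝ} (hs : s ≤ t)
    (hs' : t ≤ s') (h : corrected a b s α β w ≤ C) (h' : corrected a b s' α β w ≤ C) :
    corrected a b t α β w ≤ C := by
  rcases le_total 0 (ratTest α β w) with h0 | h0
  · exact corrected_le_of_nonneg hs' h0 h'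
  · exact corrected_le_of_nonpos hs h0 h

/-- Three test functions cover the line: a nonnegative one for `t ≤ 1.98`, a nonpositive one for `t
≥ 2.63`, and one of unrestricted sign, certified at both breakpoints, in between. -/
lemma loss_mean_le (t : ℝ) : 4 / 5 * oddMean t + evenMean t ≤ 287 / 500 := by
  rw [← one_mul (evenMean t)]
  rcases le_total t (99 / 50) with h1 | h1
  · exact mean_le_of_corrected_le fun w =>
      corrected_le_of_nonneg h1 (ratTest_left_nonneg w) (corrected_left_le w)
  rcases le_total (263 / 100) t with h2 | h2
  · exact mean_le_of_corrected_le fun w =>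
      corrected_le_of_nonpos h2 (ratTest_right_nonpos w) (corrected_right_le w)
  · exact mean_le_of_corrected_le fun w =>
      corrected_le_of_mem_Icc h1 h2 (corrected_middle_le w) (corrected_middle_le' w)

lemma evenMean_le (t : ℝ) : evenMean t ≤ 9 / 20 :=
  calc evenMean t ≤ ∫ _w, (9 / 20 : ℝ) ∂(gaussianReal t 1) :=
        integral_mono (integrable_evenKernel t) (integrable_const _) evenKernel_le
    _ = 9 / 20 := by simp

lemma evenMean_gain : evenMean (-3 / 10) ≤ -91 / 200 := by
  simpa using mean_le_of_corrected_le corrected_gain_even_le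

lemma gain_mean_le : 4 / 5 * oddMean (-3 / 10) + evenMean (-3 / 10) ≤ -23 / 40 := by
  simpa using mean_le_of_corrected_le corrected_gain_le

lemma evenMean_three_pos : 0 < evenMean 3 := by
  have := mean_le_of_corrected_le corrected_neg_even_le
  linarith

lemma integral_gaussianReal_neg (f : ℝ → ℝ) (t : ℝ) :
    ∫ w, f w ∂(gaussianReal (-t) 1) = ∫ w, f (-w) ∂(gaussianReal t 1) := by
  rw [← gaussianReal_map_neg]
  exact integral_map_equiv (MeasurableEquiv.neg ℝ) f

lemma oddMean_neg (t : ℝ) : oddMean (-t) = -oddMean t := by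
  rw [oddMean, integral_gaussianReal_neg, oddMean, ← integral_neg]
  congr with w
  simp [oddKernel, neg_div]

lemma evenMean_neg (t : ℝ) : evenMean (-t) = evenMean t := by
  rw [evenMean, integral_gaussianReal_neg, evenMean]
  congr with w
  simp [evenKernel]

/-- Moves `t` from the measure into the integrand, so that continuity and decay in `t` follow by
dominated convergence. -/
lemma integral_gaussianReal_eq_translate (f : ℝ → ℝ) (t : ℝ) :
    ∫ w, f w ∂(gaussianReal t 1) = ∫ z, f (t + z) ∂(gaussianReal 0 1) := by
  have h := gaussianReal_map_const_add (μ := 0) (v := 1) t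
  rw [zero_add] at h
  rw [← h]
  exact integral_map_equiv (MeasurableEquiv.addLeft t) f

lemma continuous_integral_gaussianReal {f : ℝ → ℝ} {C : ℝ} (hf : Continuous f)
    (hC : ∀ w, |f w| ≤ C) : Continuous fun t => ∫ w, f w ∂(gaussianReal t 1) := by
  simp_rw [integral_gaussianReal_eq_translate f]
  refine continuous_of_dominated (bound := fun _ => C) (fun t => ?_)
    (fun t => Eventually.of_forall fun z => hC _) (integrable_const _)
    (Eventually.of_forall fun z => ?_)
  · exact (by fun_prop : Continuous fun z => f (t + z)).aestronglyMeasurable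
  · fun_prop

lemma tendsto_integral_gaussianReal {f : ℝ → ℝ} {C : ℝ} (hf : Continuous f)
    (hC : ∀ w, |f w| ≤ C) (h0 : Tendsto f (cocompact ℝ) (𝓝 0)) :
    Tendsto (fun t => ∫ w, f w ∂(gaussianReal t 1)) (cocompact ℝ) (𝓝 0) := by
  simp_rw [integral_gaussianReal_eq_translate f]
  have hc : ∀ t, Continuous fun z => f (t + z) := fun t => by fun_prop
  have : (cocompact ℝ).IsCountablyGenerated := by
    rw [cocompact_eq_atBot_atTop]; infer_instance
  have h := tendsto_integral_filter_of_dominated_convergence (μ := gaussianReal 0 1)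
    (F := fun t z => f (t + z)) (f := fun _ => 0) (fun _ => C)
    (Eventually.of_forall fun t => (hc t).aestronglyMeasurable)
    (Eventually.of_forall fun t => Eventually.of_forall fun z => hC (t + z))
    (integrable_const C) (Eventually.of_forall fun z =>
      h0.comp (Homeomorph.addRight z).isClosedEmbedding.tendsto_cocompact)
  rwa [integral_zero] at h

lemma tendsto_inv_abs_cocompact : Tendsto (fun w : ℝ => |w|⁻¹) (cocompact ℝ) (𝓝 0) :=
  tendsto_inv_atTop_zero.comp (tendsto_norm_cocompact_atTop (E := ℝ))

lemma tendsto_oddKernel_cocompact : Tendsto oddKernel (cocompact ℝ) (𝓝 0) := by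
  refine squeeze_zero_norm (fun w => ?_) tendsto_inv_abs_cocompact
  rw [Real.norm_eq_abs, oddKernel, abs_div, abs_of_pos (one_add_sq_pos w), ← sq_abs w]
  rcases eq_or_ne w 0 with rfl | hw
  · simp
  have : 0 < |w| := abs_pos.2 hw
  rw [← one_div, div_le_div_iff₀ (by positivity) this]
  nlinarith

lemma tendsto_evenKernel_cocompact : Tendsto evenKernel (cocompact ℝ) (𝓝 0) := by
  have h : Tendsto (fun w : ℝ => 3 * |w|⁻¹ ^ 2) (cocompact ℝ) (𝓝 0) := by
    simpa using (tendsto_inv_abs_cocompact.pow 2).const_mul 3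
  refine squeeze_zero_norm' ?_ h
  have : ∀ᶠ w : ℝ in cocompact ℝ, 1 ≤ |w| :=
    (tendsto_norm_cocompact_atTop (E := ℝ)).eventually_ge_atTop 1
  filter_upwards [this] with w hw
  have hw0 : 0 < |w| := by linarith
  have hD := one_add_sq_pos w
  rw [Real.norm_eq_abs, evenKernel, abs_div, abs_of_pos (pow_pos hD 2), inv_pow, ← one_div,
    mul_one_div, div_le_div_iff₀ (by positivity) (by positivity), sq_abs]
  have h1 : |3 * w ^ 2 - 2| ≤ 3 * (1 + w ^ 2) := by
    rw [abs_le]; constructor <;> nlinarith [sq_nonneg w]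
  nlinarith [sq_nonneg w, mul_le_mul_of_nonneg_right h1 (sq_nonneg w)]

end Means

/-! ### The standardized risk difference -/

section RiskDifference

/-- The difference of the asymptotic mean-squared errors of the weighted and of the consistent
estimator, for unit variance, bias `m` and local parameter `t + m`. -/
noncomputable def riskDiff (m t : ℝ) : ℝ := 2 * m * oddMean t + evenMean t

lemma continuous_riskDiff (m : ℝ) : Continuous (riskDiff m) :=
  ((continuous_integral_gaussianReal continuous_oddKernel abs_oddKernel_le).const_mul _).add
    (continuous_integral_gaussianReal continuous_evenKernel abs_evenKernel_le)

lemma tendsto_riskDiff (m : ℝ) : Tendsto (riskDiff m) (cocompact ℝ) (𝓝 0) := by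
  have h := ((tendsto_integral_gaussianReal continuous_oddKernel abs_oddKernel_le
    tendsto_oddKernel_cocompact).const_mul (2 * m)).add
    (tendsto_integral_gaussianReal continuous_evenKernel abs_evenKernel_le
      tendsto_evenKernel_cocompact)
  rwa [mul_zero, add_zero] at h

lemma riskDiff_neg (m t : ℝ) : riskDiff (-m) (-t) = riskDiff m t := by
  simp [riskDiff, oddMean_neg, evenMean_neg]

/-- The odd parts cancel in the sum of the values at `3` and `-3`, leaving `2 * evenMean 3 > 0`;
hence one of the two is positive, whatever `m` is. -/
lemma exists_riskDiff_pos (m : ℝ) : ∃ t, 0 < riskDiff m t := by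
  by_contra! h
  have h1 := h 3
  have h2 := h (-3)
  have h3 := evenMean_three_pos
  simp only [riskDiff, oddMean_neg, evenMean_neg] at h1 h2
  linarith

lemma exists_forall_riskDiff_lt {m : ℝ} (hm : |m| ≤ 2 / 5) :
    ∃ t₀, ∀ t, riskDiff m t < -riskDiff m t₀ := by
  wlog h0 : 0 ≤ m generalizing m
  · obtain ⟨t₀, ht₀⟩ := this (m := -m) (by rwa [abs_neg]) (by linarith)
    refine ⟨-t₀, fun t => ?_⟩
    rw [← riskDiff_neg m t, ← riskDiff_neg m (-t₀), neg_neg]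
    exact ht₀ _
  have hm' := (abs_le.1 hm).2
  refine ⟨-3 / 10, fun t => ?_⟩
  -- With `λ = 5m/2 ∈ [0, 1]`, `2mA + B = λ (4A/5 + B) + (1 - λ) B`. The two endpoint estimates
  -- bound the sum of the values at `t` and `-3/10` by `-λ/1000 - (1 - λ)/200 < 0`.
  have e1 := mul_le_mul_of_nonneg_left (add_le_add (loss_mean_le t) gain_mean_le)
    (by positivity : 0 ≤ 5 / 2 * m)
  have e2 := mul_le_mul_of_nonneg_left (add_le_add (evenMean_le t) evenMean_gain)
    (by linarith : 0 ≤ 1 - 5 / 2 * m)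
  unfold riskDiff
  linarith

/-- A continuous function that vanishes at infinity and is positive somewhere attains its maximum.
-/
lemma exists_forall_riskDiff_le (m : ℝ) : ∃ t₀, ∀ t, riskDiff m t ≤ riskDiff m t₀ := by
  obtain ⟨t₁, h₁⟩ := exists_riskDiff_pos m
  exact (continuous_riskDiff m).exists_forall_ge' t₁
    (((tendsto_riskDiff m).eventually_lt_const h₁).mono fun _ h => h.le)

lemma exists_forall_neg_riskDiff_le {m : ℝ} (hm : |m| ≤ 2 / 5) :
    ∃ t₀, ∀ t, -riskDiff m t ≤ -riskDiff m t₀ := by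
  obtain ⟨t₁, h₁⟩ := exists_riskDiff_pos m
  -- The gain at `t₂` exceeds a positive loss, so the risk difference is negative there; together
  -- with decay at infinity this yields a minimum.
  obtain ⟨t₂, h₂⟩ := exists_forall_riskDiff_lt hm
  have hneg : riskDiff m t₂ < 0 := by linarith [h₂ t₁]
  obtain ⟨t₀, h₀⟩ := (continuous_riskDiff m).exists_forall_le' t₂
    (((tendsto_riskDiff m).eventually_const_lt hneg).mono fun _ h => h.le)
  exact ⟨t₀, fun t => neg_le_neg (h₀ t)⟩

lemma hasDerivAt_oddKernel (w : ℝ) :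
    HasDerivAt oddKernel ((1 - w ^ 2) / (1 + w ^ 2) ^ 2) w := by
  have h := (hasDerivAt_id w).div ((hasDerivAt_pow 2 w).const_add 1) (one_add_sq_pos w).ne'
  convert! h using 1
  simp
  ring

lemma integral_sub_sq_gaussianReal (m t : ℝ) :
    ∫ w, (m - (w - t)) ^ 2 ∂(gaussianReal t 1) = m ^ 2 + 1 := by
  have h1 : Integrable (fun w : ℝ => w - t) (gaussianReal t 1) :=
    ((memLp_id_gaussianReal 1).integrable (by simp)).sub (integrable_const t)
  have h2 : Integrable (fun w : ℝ => (w - t) ^ 2) (gaussianReal t 1) :=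
    (((memLp_id_gaussianReal 2).sub (memLp_const t)).integrable_sq)
  have h3 : ∫ w, (w - t) ∂(gaussianReal t 1) = 0 := by
    have h : Integrable (fun w : ℝ => w) (gaussianReal t 1) :=
      (memLp_id_gaussianReal 1).integrable (by simp)
    rw [integral_sub h (integrable_const t)]
    simp
  have h4 : ∫ w, (w - t) ^ 2 ∂(gaussianReal t 1) = 1 := by
    have := variance_fun_id_gaussianReal (μ := t) (v := 1)
    rw [variance_eq_integral (by fun_prop)] at this
    simpa using this
  have e : ∀ w : ℝ, (m - (w - t)) ^ 2 = (m ^ 2 - 2 * m * (w - t)) + (w - t) ^ 2 :=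
    fun w => by ring
  have h5 : Integrable (fun w : ℝ => m ^ 2 - 2 * m * (w - t)) (gaussianReal t 1) :=
    (integrable_const _).sub (h1.const_mul _)
  simp_rw [e]
  rw [integral_add h5 h2, integral_sub (integrable_const _) (h1.const_mul _), integral_const_mul,
    h3, h4]
  simp

/-- The mean-squared error of the limit in the standardized problem. -/
lemma integral_standardized_sq (m t : ℝ) :
    ∫ w, (m - (w - t) + oddKernel w) ^ 2 ∂(gaussianReal t 1) = m ^ 2 + 1 + riskDiff m t := by
  have hb : ∀ w : ℝ, |(1 - w ^ 2) / (1 + w ^ 2) ^ 2| ≤ 1 := by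
    intro w
    have hD := pow_pos (one_add_sq_pos w) 2
    rw [abs_div, abs_of_pos hD, div_le_one hD, abs_le]
    constructor <;> nlinarith [sq_nonneg w, sq_nonneg (w ^ 2)]
  have hc : Continuous fun w : ℝ => (1 - w ^ 2) / (1 + w ^ 2) ^ 2 :=
    Continuous.div (by fun_prop) (by fun_prop) fun w => (pow_pos (one_add_sq_pos w) 2).ne'
  have hst := integral_stein (t := t) hasDerivAt_oddKernel hc abs_oddKernel_le hb
  have i1 : Integrable (fun w : ℝ => (m - (w - t)) ^ 2) (gaussianReal t 1) :=
    ((memLp_const m).sub ((memLp_id_gaussianReal 2).sub (memLp_const t))).integrable_sq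
  have i2 : Integrable (fun w => 2 * m * oddKernel w + evenKernel w) (gaussianReal t 1) :=
    ((integrable_oddKernel t).const_mul _).add (integrable_evenKernel t)
  have i3 : Integrable (fun w => 2 * ((1 - w ^ 2) / (1 + w ^ 2) ^ 2 - (w - t) * oddKernel w))
      (gaussianReal t 1) :=
    ((integrable_of_continuous_of_bounded hc hb).sub
      (integrable_sub_mul_of_bounded continuous_oddKernel abs_oddKernel_le)).const_mul 2
  have e : ∀ w, (m - (w - t) + oddKernel w) ^ 2 = ((m - (w - t)) ^ 2 +
      (2 * m * oddKernel w + evenKernel w)) +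
      2 * ((1 - w ^ 2) / (1 + w ^ 2) ^ 2 - (w - t) * oddKernel w) := by
    intro w
    have hD := one_add_sq_pos w
    -- The relation `g² = evenKernel + 2 g'`: the cross term `-2 (w - t) g` pairs with `2 g'` into a
    -- mean-zero Stein term, and `evenKernel` remains.
    have : oddKernel w ^ 2 = evenKernel w + 2 * ((1 - w ^ 2) / (1 + w ^ 2) ^ 2) := by
      unfold oddKernel evenKernel; field_simp; ring
    linear_combination this
  simp_rw [e]
  have i12 : Integrable (fun w => (m - (w - t)) ^ 2 + (2 * m * oddKernel w + evenKernel w))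
      (gaussianReal t 1) := i1.add i2
  rw [integral_add i12 i3, integral_add i1 i2, integral_const_mul, hst,
    integral_sub_sq_gaussianReal, integral_add ((integrable_oddKernel t).const_mul _)
      (integrable_evenKernel t), integral_const_mul]
  simp [riskDiff, oddMean, evenMean]

end RiskDifference

/-! ### Risk of the limit variable -/

section LimitRisk

variable {Ω' : Type*} [MeasurableSpace Ω'] {Q : Measure Ω'} {V : Ω' → ℝ} {μ σ : ℝ}

lemma limitU_eq_add_oddKernel (hσ : 0 < σ) (h v : ℝ) :
    limitU σ h v = v + σ * oddKernel ((h - v) / σ) := by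
  have : 0 < (h - v) ^ 2 + σ ^ 2 := by positivity
  have h2 : 0 < 1 + ((h - v) / σ) ^ 2 := by positivity
  have e : 1 + ((h - v) / σ) ^ 2 = ((h - v) ^ 2 + σ ^ 2) / σ ^ 2 := by field_simp; ring
  rw [limitU, oddKernel, e]
  field_simp

lemma memLp_of_hasLaw_gaussianReal {v : NNReal} (hV : HasLaw V (gaussianReal μ v) Q) :
    MemLp V 2 Q := by
  have h : MemLp id 2 (Q.map V) := by rw [hV.map_eq]; exact memLp_id_gaussianReal 2
  exact (memLp_map_measure_iff aestronglyMeasurable_id hV.aemeasurable).1 h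

lemma integrable_limitU_sq [IsProbabilityMeasure Q] {v : NNReal} (hσ : 0 < σ)
    (hV : HasLaw V (gaussianReal μ v) Q) (h : ℝ) :
    Integrable (fun x => limitU σ h (V x) ^ 2) Q := by
  simp_rw [limitU_eq_add_oddKernel hσ]
  have hVm := hV.aemeasurable
  have hm : AEStronglyMeasurable (fun x => σ * oddKernel ((h - V x) / σ)) Q :=
    ((continuous_oddKernel.measurable.comp_aemeasurable
      (by fun_prop : AEMeasurable (fun x => (h - V x) / σ) Q)).const_mul σ).aestronglyMeasurable
  have hb : MemLp (fun x => σ * oddKernel ((h - V x) / σ)) 2 Q := by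
    refine MemLp.of_bound hm σ (Eventually.of_forall fun x => ?_)
    rw [Real.norm_eq_abs, abs_mul, abs_of_pos hσ]
    nlinarith [abs_oddKernel_le ((h - V x) / σ)]
  exact ((memLp_of_hasLaw_gaussianReal hV).add hb).integrable_sq

/-- The asymptotic risk of the weighted estimator under local alternatives. -/
lemma integral_limitU_sq (hσ : 0 < σ)
    (hV : HasLaw V (gaussianReal μ (Real.toNNReal (σ ^ 2))) Q) (h : ℝ) :
    ∫ x, limitU σ h (V x) ^ 2 ∂Q - (μ ^ 2 + σ ^ 2) =
      σ ^ 2 * riskDiff (μ / σ) ((h - μ) / σ) := by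
  -- Standardization: the mean-squared error becomes `σ²` times an integral under a unit-variance
  -- normal law whose mean carries the dependence on `h`.
  have hlaw : Q.map (fun x => (h - V x) / σ) = gaussianReal ((h - μ) / σ) 1 := by
    have h1 := (gaussianReal_div_const (gaussianReal_const_sub hV h) σ).map_eq
    rw [h1]
    congr 1
    ext
    simp [Real.coe_toNNReal _ (sq_nonneg σ), hσ.ne']
  have hVm := hV.aemeasurable
  have e : ∀ x, limitU σ h (V x) ^ 2 = (fun w => σ ^ 2 *
      (μ / σ - (w - (h - μ) / σ) + oddKernel w) ^ 2) ((h - V x) / σ) := by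
    intro x
    rw [limitU_eq_add_oddKernel hσ]
    have : V x = σ * (μ / σ - ((h - V x) / σ - (h - μ) / σ)) := by field_simp; ring
    dsimp only
    rw [← mul_pow, mul_add, ← this]
  simp_rw [e]
  have hc : Continuous (fun w => σ ^ 2 * (μ / σ - (w - (h - μ) / σ) + oddKernel w) ^ 2) := by
    have := continuous_oddKernel
    fun_prop
  rw [← integral_map (by fun_prop : AEMeasurable (fun x => (h - V x) / σ) Q)
    hc.aestronglyMeasurable, hlaw, integral_const_mul, integral_standardized_sq]
  field_simp
  ring

/-- Without bias between the estimators, weighting strictly lowers the asymptotic risk. -/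
lemma integral_shrunk_sq_lt [IsProbabilityMeasure Q] (hσ : 0 < σ)
    (hV : HasLaw V (gaussianReal μ (Real.toNNReal (σ ^ 2))) Q) :
    Integrable (fun x => (V x * (1 - σ ^ 2 / (V x ^ 2 + σ ^ 2))) ^ 2) Q ∧
    ∫ x, (V x * (1 - σ ^ 2 / (V x ^ 2 + σ ^ 2))) ^ 2 ∂Q < ∫ x, V x ^ 2 ∂Q := by
  have hi : Integrable (fun x => (V x * (1 - σ ^ 2 / (V x ^ 2 + σ ^ 2))) ^ 2) Q := by
    refine (integrable_limitU_sq hσ hV 0).congr (Eventually.of_forall fun x => ?_)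
    simp only [limitU, zero_sub, neg_sq]
    ring
  have hi' : Integrable (fun x => V x ^ 2) Q := (memLp_of_hasLaw_gaussianReal hV).integrable_sq
  refine ⟨hi, ?_⟩
  -- The inequality is already pointwise: the shrinkage factor is `v² / (v² + σ²) ∈ [0, 1)`.
  -- Equality occurs only at `v = 0`, a null event for the nondegenerate normal law.
  have key : ∀ v : ℝ, v ≠ 0 → (v * (1 - σ ^ 2 / (v ^ 2 + σ ^ 2))) ^ 2 < v ^ 2 := by
    intro v hv
    have hv2 : 0 < v ^ 2 := by positivity
    have h1 : 1 - σ ^ 2 / (v ^ 2 + σ ^ 2) = v ^ 2 / (v ^ 2 + σ ^ 2) := by field_simp; ring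
    have h2 : v ^ 2 / (v ^ 2 + σ ^ 2) < 1 := by
      rw [div_lt_one (by positivity)]; linarith [pow_pos hσ 2]
    have h3 : 0 ≤ v ^ 2 / (v ^ 2 + σ ^ 2) := by positivity
    rw [h1, mul_pow]
    nlinarith [mul_pos hv2 (sub_pos.2 h2), mul_nonneg h3 (sub_pos.2 h2).le]
  have hne : ∀ᵐ x ∂Q, V x ≠ 0 := by
    have hv : Real.toNNReal (σ ^ 2) ≠ 0 := by
      rw [Ne, Real.toNNReal_eq_zero, not_le]; positivity
    have := nullSingletonClass_gaussianReal (μ := μ) hv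
    have h0 : ∀ᵐ v ∂(gaussianReal μ (Real.toNNReal (σ ^ 2))), v ≠ 0 := by
      rw [ae_iff]; simp
    rw [← hV.map_eq] at h0
    exact ae_of_ae_map hV.aemeasurable h0
  have hlt : ∀ᵐ x ∂Q, 0 < V x ^ 2 - (V x * (1 - σ ^ 2 / (V x ^ 2 + σ ^ 2))) ^ 2 := by
    filter_upwards [hne] with x hx using sub_pos.2 (key _ hx)
  rw [← sub_pos, ← integral_sub hi' hi, integral_pos_iff_support_of_nonneg_ae
    (hlt.mono fun _ h => h.le) (hi'.sub hi), pos_iff_ne_zero]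
  intro h0
  have : ∀ᵐ _x ∂Q, False := by
    filter_upwards [hlt, measure_eq_zero_iff_ae_notMem.1 h0] with x h1 h2
    exact h2 h1.ne'
  exact IsProbabilityMeasure.ne_zero Q (by simpa using this)

end LimitRisk

theorem theorem2 {Ω : ℕ → Type u} [∀ n, MeasurableSpace (Ω n)]
    (P : ∀ n, Measure (Ω n)) [∀ n, IsProbabilityMeasure (P n)]
    (r β0 βE : ℕ → ℝ) (bC bE vC vE cCE pHat : ∀ n, Ω n → ℝ) (μ σC σE ρ : ℝ)
    (hsetup : NonparamSetup P r β0 βE bC bE vC vE cCE μ σC σE ρ)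
    (hp : IsEmpMSEWeight P bC bE vC vE cCE pHat)
    -- `V` is a normal variable with mean `μ` and variance `σC ^ 2`
    {Ω' : Type*} [MeasurableSpace Ω'] (Q : Measure Ω') [IsProbabilityMeasure Q]
    (V : Ω' → ℝ) (hV : HasLaw V (gaussianReal μ (Real.toNNReal (σC ^ 2))) Q) :
    -- fixed parameters `β0 ≠ βE`
    (∀ b0 bE0 : ℝ, b0 ≠ bE0 → (∀ n, β0 n = b0) → (∀ n, βE n = bE0) →
      TendstoInDistribution (fun n ω => r n * (betaMSE bC bE pHat n ω - β0 n)) atTop id P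
        (gaussianReal μ (Real.toNNReal (σC ^ 2)))) ∧
    -- `β0 = βE`
    (((∀ n, β0 n = βE n) →
      TendstoInDistribution (fun n ω => r n * (betaMSE bC bE pHat n ω - β0 n)) atTop
        (fun x => V x * (1 - σC ^ 2 / (V x ^ 2 + σC ^ 2))) P Q) ∧
      Integrable (fun x => V x ^ 2) Q ∧
      Integrable (fun x => (V x * (1 - σC ^ 2 / (V x ^ 2 + σC ^ 2))) ^ 2) Q ∧
      ∫ x, (V x * (1 - σC ^ 2 / (V x ^ 2 + σC ^ 2))) ^ 2 ∂Q < ∫ x, V x ^ 2 ∂Q) ∧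
    -- local alternatives `βE = β0 + h / r`
    (|μ / σC| ≤ 0.4 →
      (∀ h : ℝ, (∀ n, βE n = β0 n + h / r n) →
        TendstoInDistribution (fun n ω => r n * (betaMSE bC bE pHat n ω - β0 n)) atTop
          (fun x => limitU σC h (V x)) P Q) ∧
      (∀ h : ℝ, Integrable (fun x => limitU σC h (V x) ^ 2) Q) ∧
      ∃ maxLoss maxGain : ℝ,
        IsGreatest (Set.range fun h : ℝ =>
          ∫ x, limitU σC h (V x) ^ 2 ∂Q - (μ ^ 2 + σC ^ 2)) maxLoss ∧
        IsGreatest (Set.range fun h : ℝ =>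
          (μ ^ 2 + σC ^ 2) - ∫ x, limitU σC h (V x) ^ 2 ∂Q) maxGain ∧
        maxLoss < maxGain) := by
  have hσ := hsetup.sigmaC_pos
  have hσ2 : 0 < σC ^ 2 := by positivity
  refine ⟨fun b0 bE0 hne h0 hE => ?_, ⟨fun heq => ?_,
    (memLp_of_hasLaw_gaussianReal hV).integrable_sq, integral_shrunk_sq_lt hσ hV⟩,
    fun hm => ⟨fun h hβ => ?_, integrable_limitU_sq hσ hV, ?_⟩⟩
  · exact hsetup.tendstoInDistribution_fixed hp (sub_ne_zero.2 hne.symm)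
      fun n => by rw [h0, hE]
  · have h := hsetup.tendstoInDistribution_local hp hV (h := 0) fun n => by simp [heq n]
    refine h.congr (fun n => Eventually.of_forall fun ω => rfl) (Eventually.of_forall fun x => ?_)
    simp only [limitU, zero_sub, neg_sq]
    ring
  · exact hsetup.tendstoInDistribution_local hp hV hβ
  · have hm' : |μ / σC| ≤ 2 / 5 := by norm_num at hm ⊢; exact hm
    obtain ⟨t₁, h₁⟩ := exists_forall_riskDiff_le (μ / σC)
    obtain ⟨t₂, h₂⟩ := exists_forall_neg_riskDiff_le hm'
    obtain ⟨t₀, h₀⟩ := exists_forall_riskDiff_lt hm'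
    have hR := integral_limitU_sq hσ hV
    have hR' : ∀ h, (μ ^ 2 + σC ^ 2) - ∫ x, limitU σC h (V x) ^ 2 ∂Q =
        σC ^ 2 * -riskDiff (μ / σC) ((h - μ) / σC) := fun h => by
      rw [← neg_sub, hR h]; ring
    have ht : ∀ t, (μ + σC * t - μ) / σC = t := fun t => by field_simp; ring
    -- The extremizers in `t` return to the local parameter through `h = μ + σC t`, the inverse of
    -- the standardization, so the ranges over `h` and over `t` agree.
    refine ⟨σC ^ 2 * riskDiff (μ / σC) t₁, σC ^ 2 * -riskDiff (μ / σC) t₂,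
      ⟨⟨μ + σC * t₁, ?_⟩, ?_⟩, ⟨⟨μ + σC * t₂, ?_⟩, ?_⟩, ?_⟩
    · simp only [hR, ht]
    · rintro _ ⟨h, rfl⟩
      simp only [hR]
      exact mul_le_mul_of_nonneg_left (h₁ _) hσ2.le
    · simp only [hR', ht]
    · rintro _ ⟨h, rfl⟩
      simp only [hR']
      exact mul_le_mul_of_nonneg_left (h₂ _) hσ2.le
    -- The largest loss, at `t₁`, is below the gain at `t₀`, which is at most the largest gain, at
    -- `t₂`.
    · exact mul_lt_mul_of_pos_left ((h₀ t₁).trans_le (h₂ t₀)) hσ2
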